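/- For $n\ge 1$ let $\mathcal L_n$ be the set of words $a=(a_1,\dots,a_n)$ of non-negative integers such that (i) $a_{j+1}\ge a_j-1$ for $1\le j<n$, and (ii) if $a_j=k>0$ is the left-most occurrence of the letter $k$ in $a$, then there are $j_1<j<j_2$ with $a_{j_1}=a_{j_2}=k-1$. For $i,s,t\ge1$ let $a_i(n,s,t)$ be the number of words in $\mathcal L_n$ with exactly $s$ occurrences of the letter $i$ and exactly $t$ zeros, and put $$A(x,w,v,q)=\sum_{i\ge1}q^i\sum_{n\ge1}\sum_{s=1}^{n}\sum_{t=1}^{n}a_i(n,s,t)\,x^nw^tv^s .$$ Let $C(x)=\sum_{n\ge0}\frac1{n+1}\binom{2n}{n}x^n$, let $A(x,u)=\frac{xu}{1-xuC(x)}$, let $L_0(x,w)=\frac1{1-xw}$ and $L_j(x,w)=\frac1{1-xL_{j-1}(x,w)}$ for $j\ge1$. Let $U_j$ be the Chebyshev polynomials of the second kind, $U_0(z)=1$, $U_1(z)=2z$, $U_j(z)=2zU_{j-1}(z)-U_{j-2}(z)$, with $U_{-1}=0$, and let $t=\frac1{2\sqrt x}$ in the formula below. Let $F$ be a field of characteristic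 $0$ and let $w,v\in F$ (for instance, two indeterminates with $F=\mathbb Q(w,v)$). Then, as formal power series in $q$ over the field $F((\sqrt x))$ of formal Laurent series in $\sqrt x$, $$A(x,w,v,q)=q\sum_{j\ge0}\frac{w\sqrt{x}\,q^{j}\left(A(x,vL_{j}(x,w))-A(x,v)-\dfrac{q\sum_{i\ge0}\frac{q^{i}\left(A(x,vL_{i}(x,1))-A(x,v)\right)}{\sqrt{x}\,U_{i+2}(t)U_{i+1}(t)}}{1+q\sum_{i\ge0}\frac{q^{i}}{\sqrt{x}\,U_{i+2}(t)U_{i+1}(t)}}\right)}{\left(U_{j+1}(t)-w\sqrt{x}\,U_j(t)\right)\left(U_{j}(t)-w\sqrt{x}\,U_{j-1}(t)\right)},$$ where the outer sum converges coefficientwise in $q$. -/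

import Mathlib

open scoped PowerSeries LaurentSeries PowerSeries.WithPiTopology

namespace CatalanWords

/-- Membership in `𝓛ₙ` for a word `a = (a 0, …, a (n-1))` of non-negative integers: there are no
drops of size greater than one, and the left-most occurrence of each letter `k > 0` has a letter
`k - 1` somewhere to its left and a letter `k - 1` somewhere to its right. -/
def IsCatalanWord {n : ℕ} (a : Fin n → ℕ) : Prop :=
  (∀ i j : Fin n, (j : ℕ) = (i : ℕ) + 1 → a i ≤ a j + 1) ∧
  (∀ i : Fin n, 0 < a i → (∀ j : Fin n, j < i → a j ≠ a i) →
    ∃ i₁ i₂ : Fin n, i₁ < i ∧ i < i₂ ∧ a i₁ + 1 = a i ∧ a i₂ + 1 = a i)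

/-- The number of occurrences of the letter `i` in the word `a`. -/
def occ {n : ℕ} (a : Fin n → ℕ) (i : ℕ) : ℕ :=
  (Finset.univ.filter fun j : Fin n => a j = i).card

/-- `numWords i n s t` is `a_i(n,s,t)`: the number of members of `𝓛ₙ` with exactly `s` occurrences
of the letter `i` and exactly `t` zeros. -/
noncomputable def numWords (i n s t : ℕ) : ℕ :=
  {a : Fin n → ℕ | IsCatalanWord a ∧ occ a i = s ∧ occ a 0 = t}.ncard

theorem IsCatalanWord.le_index {n : ℕ} {a : Fin n → ℕ} (h : IsCatalanWord a) :
    ∀ (m : ℕ) (i : Fin n), (i : ℕ) = m → a i ≤ m := by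
  intro m
  induction m using Nat.strong_induction_on with
  | _ m ih =>
    intro i hi
    by_cases h0 : a i = 0
    · omega
    by_cases hf : ∀ j : Fin n, j < i → a j ≠ a i
    · obtain ⟨i₁, _, h1, _, h3, _⟩ := h.2 i (Nat.pos_of_ne_zero h0) hf
      have hlt : (i₁ : ℕ) < m := hi ▸ h1
      have := ih i₁ hlt i₁ rfl
      omega
    · push Not at hf
      obtain ⟨j, hj, hja⟩ := hf
      have hlt : (j : ℕ) < m := hi ▸ hj
      have := ih j hlt j rfl
      omega

/-- There are finitely many words in `𝓛ₙ`, so that `numWords` is a genuine cardinality. -/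
theorem finite_isCatalanWord (n : ℕ) : {a : Fin n → ℕ | IsCatalanWord a}.Finite := by
  refine Set.Finite.subset (Set.finite_Iic (fun i : Fin n => (i : ℕ))) ?_
  intro a ha i
  exact ha.le_index i i rfl

section GeneratingFunctions

variable {F : Type*} [Field F]

/-- The element `√x` of the field `F((√x))` of formal Laurent series in the variable `√x`. -/
noncomputable def sqrtX : F⸨X⸩ := HahnSeries.single 1 1

/-- The element `x` of `F((√x))`. -/
noncomputable def x : F⸨X⸩ := sqrtX ^ 2

/-- A formal power series `f(x)`, seen as an element of `F((√x))`. -/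
noncomputable def inX (f : F⟦X⟧) : F⸨X⸩ :=
  HahnSeries.ofPowerSeries ℤ F (PowerSeries.expand 2 two_ne_zero f)

/-- A constant of `F`, seen as an element of `F((√x))`. -/
noncomputable def const (w : F) : F⸨X⸩ := HahnSeries.C w

/-- `A_i(x,w,v) = ∑_{n,s,t ≥ 1} a_i(n,s,t) xⁿ wᵗ vˢ`. -/
noncomputable def letterSeries (w v : F) (i : ℕ) : F⟦X⟧ :=
  PowerSeries.mk fun n =>
    ∑ s ∈ Finset.Icc 1 n, ∑ t ∈ Finset.Icc 1 n, (numWords i n s t : F) * w ^ t * v ^ s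

/-- `A(x,w,v,q) = ∑_{i ≥ 1} A_i(x,w,v) qⁱ`, a power series in `q` over `F((√x))`. -/
noncomputable def fullSeries (w v : F) : F⸨X⸩⟦X⟧ :=
  PowerSeries.mk fun i => if i = 0 then 0 else inX (letterSeries w v i)

/-- The Catalan series `C(x) = ∑_{n ≥ 0} C_n xⁿ`. -/
noncomputable def catalanC : F⸨X⸩ := inX (PowerSeries.mk fun n => (catalan n : F))

/-- `A(x,u) = x u / (1 - x u C(x))`. -/
noncomputable def A₂ (u : F⸨X⸩) : F⸨X⸩ := x * u / (1 - x * u * catalanC)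

/-- `L_0(x,w) = 1 / (1 - x w)` and `L_j(x,w) = 1 / (1 - x L_{j-1}(x,w))` for `j ≥ 1`. -/
noncomputable def L (w : F) : ℕ → F⸨X⸩
  | 0 => 1 / (1 - x * const w)
  | j + 1 => 1 / (1 - x * L w j)

/-- `U_j(t)` at `t = 1 / (2 √x)`, where `U_j` is the Chebyshev polynomial of the second kind
(with the usual convention `U_{-1} = 0`). -/
noncomputable def chebU (j : ℤ) : F⸨X⸩ :=
  (Polynomial.Chebyshev.U F⸨X⸩ j).eval (1 / (2 * sqrtX))

/-- `∑_{i ≥ 0} qⁱ (A(x, v L_i(x,1)) - A(x,v)) / (√x U_{i+2}(t) U_{i+1}(t))` as a power series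
in `q`. -/
noncomputable def numerSeries (v : F) : F⸨X⸩⟦X⟧ :=
  PowerSeries.mk fun i : ℕ =>
    (A₂ (const v * L 1 i) - A₂ (const v)) / (sqrtX * chebU (i + 2) * chebU (i + 1))

/-- `∑_{i ≥ 0} qⁱ / (√x U_{i+2}(t) U_{i+1}(t))` as a power series in `q`. -/
noncomputable def denomSeries : F⸨X⸩⟦X⟧ :=
  PowerSeries.mk fun i : ℕ => 1 / (sqrtX * chebU (i + 2) * chebU (i + 1))

/-- The variable `q`. -/
noncomputable def q : F⸨X⸩⟦X⟧ := PowerSeries.X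

end GeneratingFunctions

end CatalanWords

namespace CatalanWords

open PowerSeries Finset

/-- `f 0 + f 1 + ⋯ = A` in the `X`-adic sense, with the tail from `N` on divisible by `X ^ N`. -/
def SumsTo {R : Type*} [CommRing R] (f : ℕ → R⟦X⟧) (A : R⟦X⟧) : Prop :=
  ∀ N, (X : R⟦X⟧) ^ N ∣ A - ∑ t ∈ range N, f t

namespace SumsTo

variable {R : Type*} [CommRing R] {f g : ℕ → R⟦X⟧} {A B : R⟦X⟧}

theorem eq_of_forall_X_pow_dvd_sub
    (h : ∀ N, (X : R⟦X⟧) ^ N ∣ A - B) : A = B := by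
  ext n
  have := X_pow_dvd_iff.1 (h (n + 1)) n (Nat.lt_succ_self n)
  rwa [map_sub, sub_eq_zero] at this

theorem unique (hA : SumsTo f A) (hB : SumsTo f B) : A = B :=
  eq_of_forall_X_pow_dvd_sub fun N => by
    simpa using dvd_sub (hA N) (hB N)

theorem congr (h : SumsTo f A) (hfg : ∀ t, f t = g t) (hAB : A = B) : SumsTo g B := by
  rwa [← hAB, ← funext hfg]

theorem const_mul (c : R⟦X⟧) (h : SumsTo f A) : SumsTo (fun t => c * f t) (c * A) := fun N => by
  rw [← Finset.mul_sum, ← mul_sub]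
  exact (h N).mul_left c

theorem sub (hA : SumsTo f A) (hB : SumsTo g B) : SumsTo (fun t => f t - g t) (A - B) :=
  fun N => by
    rw [Finset.sum_sub_distrib, sub_sub_sub_comm]
    exact dvd_sub (hA N) (hB N)

theorem swap {f : ℕ → ℕ → R⟦X⟧} {r c : ℕ → R⟦X⟧} (h : SumsTo r A) (hr : ∀ t, SumsTo (f t) (r t))
    (hc : ∀ b, SumsTo (fun t => f t b) (c b)) : SumsTo c A := fun N => by
  have h1 : X ^ N ∣ ∑ t ∈ range N, (r t - ∑ b ∈ range N, f t b) :=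
    Finset.dvd_sum fun t _ => hr t N
  have h2 : X ^ N ∣ ∑ b ∈ range N, (c b - ∑ t ∈ range N, f t b) :=
    Finset.dvd_sum fun b _ => hc b N
  rw [Finset.sum_sub_distrib] at h1 h2
  rw [Finset.sum_comm] at h2
  have := dvd_sub (dvd_add (h N) h1) h2
  convert this using 1
  ring

/-- Every series whose `t`-th term is divisible by `X ^ t` sums to its coefficientwise sum. -/
theorem mk_coeff (hf : ∀ t, (X : R⟦X⟧) ^ t ∣ f t) :
    SumsTo f (PowerSeries.mk fun n => ∑ t ∈ range (n + 1), coeff n (f t)) := fun N => by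
  rw [X_pow_dvd_iff]
  intro m hm
  rw [map_sub, coeff_mk, map_sum, sub_eq_zero]
  refine Finset.sum_subset (Finset.range_subset_range.2 hm) fun t _ ht => ?_
  refine X_pow_dvd_iff.1 (hf t) m ?_
  simpa using ht

theorem choose {y z : R⟦X⟧} (hy : X ∣ y) (hz : z * (1 - y) = 1) (b : ℕ) :
    SumsTo (fun t => ((t + b).choose b : R⟦X⟧) * y ^ t) (z ^ (b + 1)) := by
  induction b with
  | zero =>
    intro N
    have h : z ^ (0 + 1) - ∑ t ∈ range N, (((t + 0).choose 0 : ℕ) : R⟦X⟧) * y ^ t = z * y ^ N := by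
      have h1 := geom_sum_mul_neg y N
      simp only [Nat.choose_zero_right, Nat.cast_one, one_mul, zero_add, pow_one]
      linear_combination (∑ t ∈ range N, y ^ t) * hz - z * h1
    rw [h]
    exact (pow_dvd_pow_of_dvd hy N).mul_left z
  | succ b ih =>
    intro N
    set S : ℕ → R⟦X⟧ := fun N => ∑ t ∈ range N, ((t + b).choose b : R⟦X⟧) * y ^ t with hS
    set T : ℕ → R⟦X⟧ := fun N => ∑ t ∈ range N, ((t + (b + 1)).choose (b + 1) : R⟦X⟧) * y ^ t
      with hT
    have key : ∀ N, (1 - y) * T N = S N - ((N + b).choose (b + 1) : R⟦X⟧) * y ^ N := by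
      intro N
      induction N with
      | zero => simp [hS, hT]
      | succ N ihN =>
        have e1 : T (N + 1) = T N + ((N + (b + 1)).choose (b + 1) : R⟦X⟧) * y ^ N :=
          Finset.sum_range_succ _ _
        have e2 : S (N + 1) = S N + ((N + b).choose b : R⟦X⟧) * y ^ N :=
          Finset.sum_range_succ _ _
        have e3 : ((N + (b + 1)).choose (b + 1) : R⟦X⟧) =
            (N + b).choose b + (N + b).choose (b + 1) := by
          rw [← add_assoc, Nat.choose_succ_succ]; push_cast; ring
        have e4 : N + 1 + b = N + (b + 1) := by ring
        rw [e1, e2, mul_add, ihN, e4, e3]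
        ring
    have h : z ^ (b + 1 + 1) - T N =
        z * (z ^ (b + 1) - S N) + z * ((N + b).choose (b + 1) : R⟦X⟧) * y ^ N := by
      linear_combination T N * hz - z * key N
    rw [h]
    exact dvd_add ((ih N).mul_left z) ((pow_dvd_pow_of_dvd hy N).mul_left _)

end SumsTo

section Transfer

variable {F : Type*} [Field F]

/-- The number of binary words with `t + 1` zeros and `b + 1` ones in which the left-most one has a
zero on either side. -/
def shuffleCount (t b : ℕ) : ℕ := (t + b + 1).choose (b + 1) - 1

theorem cast_shuffleCount (R : Type*) [CommRing R] (t b : ℕ) :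
    (shuffleCount t b : R) = (t + b + 1).choose (b + 1) - 1 := by
  rw [shuffleCount, Nat.cast_sub (Nat.choose_pos (by omega)), Nat.cast_one]

/-- `∑_{t ≥ 0} (x u)^{t+1} K_t`. -/
noncomputable def evalAt (K : ℕ → F⟦X⟧) (u : F⟦X⟧) : F⟦X⟧ :=
  PowerSeries.mk fun n => ∑ t ∈ range (n + 1), coeff n ((X * u) ^ (t + 1) * K t)

theorem evalAt_sumsTo (K : ℕ → F⟦X⟧) (u : F⟦X⟧) :
    SumsTo (fun t => (X * u) ^ (t + 1) * K t) (evalAt K u) :=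
  SumsTo.mk_coeff fun t => Dvd.dvd.mul_right (by
    rw [mul_pow]
    exact (pow_dvd_pow X (Nat.le_succ t)).mul_right _) _

theorem evalAt_geometric (v u c z : F⟦X⟧) (hz : z * (1 - X * u * v * c) = 1) :
    evalAt (fun t => v ^ (t + 1) * c ^ t) u = X * u * v * z := by
  refine (evalAt_sumsTo _ u).unique ?_
  have h := (SumsTo.choose (y := X * u * v * c) ⟨u * v * c, by ring⟩ hz 0).const_mul (X * u * v)
  refine h.congr (fun t => ?_) (by ring)
  simp only [Nat.choose_zero_right, Nat.cast_one]
  ring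

theorem evalAt_transfer {K K' : ℕ → F⟦X⟧}
    (hK : ∀ t, SumsTo (fun b => (shuffleCount t b : F⟦X⟧) * (X ^ (b + 1) * K b)) (K' t))
    {u z : F⟦X⟧} (hz : z * (1 - X * u) = 1) :
    evalAt K' u = X * u * z * (evalAt K z - evalAt K 1) := by
  have h1 := ((evalAt_sumsTo K z).sub (evalAt_sumsTo K 1)).const_mul (X * u * z)
  refine (evalAt_sumsTo K' u).unique (SumsTo.swap
    (f := fun b t => (X * u) ^ (t + 1) * ((shuffleCount t b : F⟦X⟧) * (X ^ (b + 1) * K b)))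
    h1 (fun b => ?_) (fun t => (hK t).const_mul _))
  have h2 := (SumsTo.choose (y := X * u) (dvd_mul_right X u) hz (b + 1)).sub
    (SumsTo.choose (y := X * u) (dvd_mul_right X u) hz 0)
  refine (h2.const_mul (X * u * (X ^ (b + 1) * K b))).congr (fun t => ?_) (by ring)
  rw [cast_shuffleCount, Nat.choose_zero_right, Nat.cast_one, add_assoc]
  ring

/-- The Catalan series with coefficients in `F`. -/
noncomputable def catalanF (F : Type*) [Field F] : F⟦X⟧ := PowerSeries.mk fun n => (catalan n : F)

theorem catalanF_mul : catalanF F * (1 - X * catalanF F) = 1 := by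
  have h := congrArg (PowerSeries.map (Nat.castRingHom F)) catalanSeries_sq_mul_X_add_one
  have e : PowerSeries.map (Nat.castRingHom F) catalanSeries = catalanF F := by
    ext n; simp [catalanF, catalanSeries]
  simp only [map_add, map_mul, map_pow, PowerSeries.map_X, map_one, e] at h
  linear_combination -h

theorem catalanF_pow_sumsTo (t : ℕ) :
    SumsTo (fun b => (shuffleCount t b : F⟦X⟧) * (X ^ (b + 1) * catalanF F ^ b))
      (catalanF F ^ t - 1) := by
  set c := catalanF F with hc
  have hz : c * (1 - X * c) = 1 := catalanF_mul
  have hX : X ∣ X * c := dvd_mul_right X c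
  have h : SumsTo (fun b => c * ((shuffleCount t b : F⟦X⟧) * (X ^ (b + 1) * c ^ b)))
      (c * (c ^ t - 1)) := by
    intro N
    have h1 := SumsTo.choose hX hz t (N + 1)
    have h2 := SumsTo.choose hX hz 0 (N + 1)
    have h3 := (pow_dvd_pow X (Nat.le_succ N)).trans (dvd_sub h1 h2)
    convert h3 using 1
    rw [Finset.sum_range_succ', Finset.sum_range_succ']
    simp only [cast_shuffleCount, Nat.choose_zero_right, Nat.cast_one, Nat.choose_self, zero_add,
      pow_zero]
    have e : ∀ b : ℕ, c * ((((t + b + 1).choose (b + 1) : F⟦X⟧) - 1) * (X ^ (b + 1) * c ^ b)) =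
        ((b + 1 + t).choose t : F⟦X⟧) * (X * c) ^ (b + 1) - 1 * (X * c) ^ (b + 1) := by
      intro b
      have : (t + b + 1).choose (b + 1) = (b + 1 + t).choose t := by
        rw [show t + b + 1 = b + 1 + t by ring, Nat.choose_symm_add]
      rw [this]
      ring
    simp only [e, Finset.sum_sub_distrib]
    ring
  have h4 := h.const_mul (1 - X * c)
  refine h4.congr (fun b => ?_) ?_
  · rw [← mul_assoc, mul_comm (1 - X * c), hz, one_mul]
  · rw [← mul_assoc, mul_comm (1 - X * c), hz, one_mul]

/-- The powers of the Catalan series are determined by their transfer equation. -/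
theorem eq_catalanF_pow {Z : ℕ → F⟦X⟧}
    (hZ : ∀ t, SumsTo (fun b => (shuffleCount t b : F⟦X⟧) * (X ^ (b + 1) * Z b)) (Z t - 1)) (t : ℕ) :
    Z t = catalanF F ^ t := by
  have key : ∀ N t, (X : F⟦X⟧) ^ N ∣ Z t - catalanF F ^ t := by
    intro N
    induction N with
    | zero => simp
    | succ N ih =>
      intro t
      have h := ((hZ t).sub (catalanF_pow_sumsTo t)) (N + 1)
      have h2 : (X : F⟦X⟧) ^ (N + 1) ∣ ∑ b ∈ range (N + 1),
          ((shuffleCount t b : F⟦X⟧) * (X ^ (b + 1) * Z b) -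
            (shuffleCount t b : F⟦X⟧) * (X ^ (b + 1) * catalanF F ^ b)) := by
        refine Finset.dvd_sum fun b _ => ?_
        rw [← mul_sub, ← mul_sub, pow_succ' X b, pow_succ' X N, mul_assoc]
        refine Dvd.dvd.mul_left (mul_dvd_mul_left X ((ih b).mul_left _)) _
      have := dvd_add h h2
      convert this using 1
      ring
  exact SumsTo.eq_of_forall_X_pow_dvd_sub fun N => key N t

end Transfer

section Lists

/-- If `k + 1` occurs in the word, then its left-most occurrence has a `k` on either side. -/
def Enclosed (k : ℕ) (l : List ℕ) : Prop :=
  k + 1 ∈ l → ∃ l₁ l₂, l = l₁ ++ (k + 1) :: l₂ ∧ k + 1 ∉ l₁ ∧ k ∈ l₁ ∧ k ∈ l₂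

/-- `IsCatalanWord` for lists. -/
def IsCatalanList (l : List ℕ) : Prop :=
  l.IsChain (fun a b => a ≤ b + 1) ∧ ∀ k, Enclosed k l

theorem enclosed_filter {k : ℕ} {l : List ℕ} {p : ℕ → Bool} (h0 : p k) (h1 : p (k + 1)) :
    Enclosed k (l.filter p) ↔ Enclosed k l := by
  unfold Enclosed
  rw [List.mem_filter, and_iff_left h1]
  refine imp_congr_right fun _ => ⟨?_, ?_⟩
  · rintro ⟨s₁, s₂, hs, hn, m1, m2⟩
    obtain ⟨l₁, l₂, rfl, rfl, h2⟩ := List.filter_eq_append_iff.1 hs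
    obtain ⟨l₃, l₄, rfl, h3, -, rfl⟩ := List.filter_eq_cons_iff.1 h2
    refine ⟨l₁ ++ l₃, l₄, by simp, ?_, ?_, (List.mem_filter.1 m2).1⟩
    · rw [List.mem_append, not_or]
      exact ⟨fun h => hn (List.mem_filter.2 ⟨h, h1⟩), fun h => h3 _ h h1⟩
    · exact List.mem_append_left _ (List.mem_filter.1 m1).1
  · rintro ⟨l₁, l₂, rfl, hn, m1, m2⟩
    exact ⟨l₁.filter p, l₂.filter p, by simp [h1], fun h => hn (List.mem_filter.1 h).1,
      List.mem_filter.2 ⟨m1, h0⟩, List.mem_filter.2 ⟨m2, h0⟩⟩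

theorem enclosed_map_succ {k : ℕ} {l : List ℕ} :
    Enclosed (k + 1) (l.map Nat.succ) ↔ Enclosed k l := by
  have hm : ∀ (j : ℕ) (l : List ℕ), j + 1 ∈ l.map Nat.succ ↔ j ∈ l := fun j l =>
    List.mem_map_of_injective Nat.succ_injective
  unfold Enclosed
  rw [hm]
  refine imp_congr_right fun _ => ⟨?_, ?_⟩
  · rintro ⟨s₁, s₂, hs, hn, m1, m2⟩
    obtain ⟨l₁, l₂, rfl, rfl, h2⟩ := List.map_eq_append_iff.1 hs
    obtain ⟨a, l₄, rfl, h3, rfl⟩ := List.map_eq_cons_iff.1 h2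
    obtain rfl : a = k + 1 := Nat.succ_injective h3
    rw [hm] at hn m1 m2
    exact ⟨l₁, l₄, rfl, hn, m1, m2⟩
  · rintro ⟨l₁, l₂, rfl, hn, m1, m2⟩
    exact ⟨l₁.map Nat.succ, l₂.map Nat.succ, by simp, by rwa [hm], by rwa [hm], by rwa [hm]⟩

/-- The subword of the letters `0` and `1`. -/
def low (l : List ℕ) : List ℕ := l.filter (· ≤ 1)

/-- The subword of the positive letters, each decreased by one. -/
def high (l : List ℕ) : List ℕ := (l.filter (1 ≤ ·)).map Nat.pred

@[simp] theorem low_nil : low [] = [] := rfl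
@[simp] theorem low_zero (l : List ℕ) : low (0 :: l) = 0 :: low l := by simp [low]
@[simp] theorem low_one (l : List ℕ) : low (1 :: l) = 1 :: low l := by simp [low]
@[simp] theorem low_add_two (a : ℕ) (l : List ℕ) : low ((a + 2) :: l) = low l := by simp [low]
@[simp] theorem high_nil : high [] = [] := rfl
@[simp] theorem high_zero (l : List ℕ) : high (0 :: l) = high l := by simp [high]
@[simp] theorem high_succ (a : ℕ) (l : List ℕ) : high ((a + 1) :: l) = a :: high l := by
  simp [high]

theorem map_succ_high (l : List ℕ) : (high l).map Nat.succ = l.filter (1 ≤ ·) := by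
  induction l with
  | nil => rfl
  | cons a l ih => cases a <;> simp_all [high]

theorem enclosed_zero_low {l : List ℕ} : Enclosed 0 (low l) ↔ Enclosed 0 l :=
  enclosed_filter (by simp) (by simp)

theorem enclosed_high {k : ℕ} {l : List ℕ} : Enclosed k (high l) ↔ Enclosed (k + 1) l := by
  rw [← enclosed_map_succ, map_succ_high, enclosed_filter (by simp) (by simp)]

theorem count_low_zero (l : List ℕ) : (low l).count 0 = l.count 0 := by simp [low]

theorem count_low_one (l : List ℕ) : (low l).count 1 = l.count 1 := by simp [low]

theorem count_high (k : ℕ) (l : List ℕ) : (high l).count k = l.count (k + 1) := by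
  rw [← List.count_map_of_injective _ _ Nat.succ_injective, map_succ_high]
  simp

theorem length_high (l : List ℕ) : (high l).length + l.count 0 = l.length := by
  induction l with
  | nil => rfl
  | cons a l ih => cases a <;> simp <;> omega

theorem isChain_high {l : List ℕ} (h : l.IsChain (fun a b => a ≤ b + 1)) :
    (high l).IsChain (fun a b => a ≤ b + 1) := by
  induction l with
  | nil => simp
  | cons a l ih =>
    rw [List.isChain_cons] at h
    obtain ⟨h1, h2⟩ := h
    cases a with
    | zero => simpa using ih h2
    | succ a =>
      rw [high_succ, List.isChain_cons]
      refine ⟨fun y hy => ?_, ih h2⟩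
      cases l with
      | nil => simp at hy
      | cons b l =>
        have := h1 b (by simp)
        cases b with
        | zero => omega
        | succ b =>
          simp at hy
          omega

theorem IsCatalanList.high {l : List ℕ} (h : IsCatalanList l) : IsCatalanList (high l) :=
  ⟨isChain_high h.1, fun k => enclosed_high.2 (h.2 (k + 1))⟩

/-- The word with given subword `s` on the letters `0`, `1` and given word `b` of positive letters,
decreased by one, in which zeros stand only at the beginning or after letters at most one. -/
def merge : List ℕ → List ℕ → List ℕ
  | [], b => b.map Nat.succ
  | 0 :: s, b => 0 :: merge s b
  | (_ + 1) :: _, [] => []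
  | (_ + 1) :: s, 0 :: b => 1 :: merge s b
  | (i + 1) :: s, (k + 1) :: b => (k + 2) :: merge ((i + 1) :: s) b
termination_by s b => s.length + b.length

theorem not_low_eq_zero_cons {a : ℕ} {l s : List ℕ}
    (h : ((a + 2) :: l).IsChain (fun a b => a ≤ b + 1)) : low l ≠ 0 :: s := by
  induction l generalizing a with
  | nil => simp
  | cons b l ih =>
    rw [List.isChain_cons_cons] at h
    match b, h with
    | 0, h => omega
    | 1, h => simp
    | b + 2, h => simpa using ih h.2

theorem merge_low_high {l : List ℕ} (h : l.IsChain (fun a b => a ≤ b + 1)) :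
    merge (low l) (high l) = l := by
  induction l with
  | nil => simp [merge]
  | cons a l ih =>
    have ih := ih h.tail
    match a, h with
    | 0, h => simp [merge, ih]
    | 1, h => simp [merge, ih]
    | a + 2, h =>
      rw [low_add_two, high_succ]
      have h0 := fun s => not_low_eq_zero_cons (s := s) h
      have hmem : ∀ x ∈ low l, x ≤ 1 := by simp [low]
      revert ih h0 hmem
      cases low l with
      | nil => simp +contextual [merge]
      | cons c s =>
        intro ih h0 hmem
        cases c with
        | zero => exact absurd rfl (h0 s)
        | succ c => rw [merge, ih]

theorem low_merge {s b : List ℕ} (hs : ∀ x ∈ s, x ≤ 1) (h : s.count 1 = b.count 0) :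
    low (merge s b) = s := by
  fun_induction merge s b with
  | case1 b =>
    rw [List.count_nil, eq_comm, List.count_eq_zero] at h
    rw [low, List.filter_eq_nil_iff]
    simp only [List.mem_map, decide_eq_true_eq, not_le, forall_exists_index, and_imp]
    rintro _ x hx rfl
    have : x ≠ 0 := fun h0 => h (h0 ▸ hx)
    simp only [Nat.succ_eq_add_one]
    omega
  | case2 s b ih =>
    rw [low_zero, ih (fun x hx => hs x (List.mem_cons_of_mem _ hx)) (by simpa using h)]
  | case3 i s =>
    obtain rfl : i = 0 := by have := hs (i + 1) (by simp); omega
    simp at h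
  | case4 i s b ih =>
    obtain rfl : i = 0 := by have := hs (i + 1) (by simp); omega
    rw [low_one, ih (fun x hx => hs x (List.mem_cons_of_mem _ hx)) (by simpa using h)]
  | case5 i s k b ih =>
    rw [low_add_two, ih hs (by simpa using h)]

theorem high_merge {s b : List ℕ} (hs : ∀ x ∈ s, x ≤ 1) (h : s.count 1 = b.count 0) :
    high (merge s b) = b := by
  fun_induction merge s b with
  | case1 b =>
    induction b with
    | nil => rfl
    | cons a b ih =>
      have : b.count 0 = 0 := by
        have := List.count_le_count_cons (a := 0) (b := a) (l := b)
        simp only [List.count_nil] at h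
        omega
      simpa using ih (by simp [this])
  | case2 s b ih =>
    rw [high_zero, ih (fun x hx => hs x (List.mem_cons_of_mem _ hx)) (by simpa using h)]
  | case3 i s =>
    obtain rfl : i = 0 := by have := hs (i + 1) (by simp); omega
    simp at h
  | case4 i s b ih =>
    obtain rfl : i = 0 := by have := hs (i + 1) (by simp); omega
    rw [high_succ, ih (fun x hx => hs x (List.mem_cons_of_mem _ hx)) (by simpa using h)]
  | case5 i s k b ih =>
    rw [high_succ, ih hs (by simpa using h)]

theorem isChain_merge {s b : List ℕ} (hs : ∀ x ∈ s, x ≤ 1) (h : s.count 1 = b.count 0)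
    (hb : b.IsChain (fun a b => a ≤ b + 1)) :
    (merge s b).IsChain (fun a b => a ≤ b + 1) := by
  fun_induction merge s b with
  | case1 b => exact (List.isChain_map Nat.succ).2 (hb.imp fun a b hab => by simpa using hab)
  | case2 s b ih =>
    rw [List.isChain_cons]
    exact ⟨fun y _ => by omega,
      ih (fun x hx => hs x (List.mem_cons_of_mem _ hx)) (by simpa using h) hb⟩
  | case3 i s => simp
  | case4 i s b ih =>
    obtain rfl : i = 0 := by have := hs (i + 1) (by simp); omega
    rw [List.isChain_cons]
    exact ⟨fun y _ => by omega,
      ih (fun x hx => hs x (List.mem_cons_of_mem _ hx)) (by simpa using h) hb.tail⟩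
  | case5 i s k b ih =>
    obtain rfl : i = 0 := by have := hs (i + 1) (by simp); omega
    rw [List.isChain_cons]
    refine ⟨?_, ih hs (by simpa using h) hb.tail⟩
    cases b with
    | nil => simp at h
    | cons c b =>
      have hc : k + 1 ≤ c + 1 := (List.isChain_cons_cons.1 hb).1
      cases c with
      | zero => rw [merge]; simp; omega
      | succ c => rw [merge]; simp; omega

theorem isCatalanList_merge {s b : List ℕ} (hs : ∀ x ∈ s, x ≤ 1) (h : s.count 1 = b.count 0)
    (hE : Enclosed 0 s) (hb : IsCatalanList b) : IsCatalanList (merge s b) := by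
  refine ⟨isChain_merge hs h hb.1, fun k => ?_⟩
  cases k with
  | zero => rwa [← enclosed_zero_low, low_merge hs h]
  | succ k => rw [← enclosed_high, high_merge hs h]; exact hb.2 k

theorem IsCatalanList.eq_nil {l : List ℕ} (h : IsCatalanList l) (h0 : l.count 0 = 0) : l = [] := by
  rw [List.count_eq_zero] at h0
  have : ∀ k, k ∉ l := by
    intro k
    induction k with
    | zero => exact h0
    | succ k ih =>
      intro hk
      obtain ⟨l₁, l₂, rfl, -, m, -⟩ := h.2 k hk
      exact ih (List.mem_append_left _ m)
  exact List.eq_nil_iff_forall_not_mem.2 this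

end Lists

section Binary

/-- The binary words with `t` zeros and `b` ones. -/
def binaryWords : ℕ → ℕ → Finset (List ℕ)
  | 0, b => {List.replicate b 1}
  | t + 1, 0 => {List.replicate (t + 1) 0}
  | t + 1, b + 1 => (binaryWords t (b + 1)).map ⟨List.cons 0, List.cons_injective⟩ ∪
      (binaryWords (t + 1) b).map ⟨List.cons 1, List.cons_injective⟩
termination_by t b => t + b

theorem mem_binaryWords {t b : ℕ} {s : List ℕ} :
    s ∈ binaryWords t b ↔ (∀ x ∈ s, x ≤ 1) ∧ s.count 0 = t ∧ s.count 1 = b := by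
  fun_induction binaryWords t b generalizing s with
  | case1 b =>
    rw [Finset.mem_singleton, List.eq_replicate_iff]
    constructor
    · rintro ⟨rfl, h⟩
      refine ⟨fun x hx => (h x hx).le, ?_, ?_⟩
      · exact List.count_eq_zero.2 fun h0 => absurd (h 0 h0) (by simp)
      · exact List.count_eq_length.2 fun x hx => (h x hx).symm
    · rintro ⟨h, h0, rfl⟩
      have h1 : ∀ x ∈ s, x = 1 := fun x hx => by
        have := h x hx
        have : x ≠ 0 := fun hx0 => List.count_eq_zero.1 h0 (hx0 ▸ hx)
        omega
      exact ⟨(List.count_eq_length.2 fun x hx => (h1 x hx).symm).symm, h1⟩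
  | case2 t =>
    rw [Finset.mem_singleton, List.eq_replicate_iff]
    constructor
    · rintro ⟨h2, h⟩
      refine ⟨fun x hx => (h x hx).le.trans zero_le_one, ?_, ?_⟩
      · exact (List.count_eq_length.2 fun x hx => (h x hx).symm).trans h2
      · exact List.count_eq_zero.2 fun h0 => absurd (h 1 h0) (by simp)
    · rintro ⟨h, h0, h1⟩
      have h1 : ∀ x ∈ s, x = 0 := fun x hx => by
        have := h x hx
        have : x ≠ 1 := fun hx0 => List.count_eq_zero.1 h1 (hx0 ▸ hx)
        omega
      exact ⟨(List.count_eq_length.2 fun x hx => (h1 x hx).symm).symm.trans h0, h1⟩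
  | case3 t b ih1 ih2 =>
    simp only [Finset.mem_union, Finset.mem_map, Function.Embedding.coeFn_mk, ih1, ih2]
    constructor
    · rintro (⟨s, ⟨h, h0, h1⟩, rfl⟩ | ⟨s, ⟨h, h0, h1⟩, rfl⟩) <;> simp_all
    · rintro ⟨h, h0, h1⟩
      cases s with
      | nil => simp at h0
      | cons a s =>
        have ha := h a (by simp)
        interval_cases a
        · exact Or.inl ⟨s, by simp_all, rfl⟩
        · exact Or.inr ⟨s, by simp_all, rfl⟩

theorem card_binaryWords (t b : ℕ) : (binaryWords t b).card = (t + b).choose b := by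
  fun_induction binaryWords t b with
  | case1 b => simp
  | case2 t => simp
  | case3 t b ih1 ih2 =>
    rw [Finset.card_union_of_disjoint, Finset.card_map, Finset.card_map, ih1, ih2,
      show t + 1 + (b + 1) = (t + 1 + b) + 1 by ring, Nat.choose_succ_succ,
      show t + (b + 1) = t + 1 + b by ring, add_comm]
    rw [Finset.disjoint_left]
    simp only [Finset.mem_map, Function.Embedding.coeFn_mk]
    rintro _ ⟨s, -, rfl⟩ ⟨s', -, h⟩
    simp at h

theorem enclosed_zero_binary_iff {t b : ℕ} {s : List ℕ} (hs : s ∈ binaryWords (t + 1) (b + 1)) :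
    Enclosed 0 s ↔ ∃ s' ∈ (binaryWords t (b + 1)).erase
      (List.replicate t 0 ++ List.replicate (b + 1) 1), 0 :: s' = s := by
  rw [mem_binaryWords] at hs
  obtain ⟨h, h0, h1⟩ := hs
  have hmem : 1 ∈ s := List.count_pos_iff.1 (by omega)
  constructor
  · intro hE
    obtain ⟨s₁, s₂, rfl, hn, m1, m2⟩ := hE hmem
    cases s₁ with
    | nil => simp at m1
    | cons a s₁ =>
      obtain rfl : a = 0 := by
        have := h a (by simp)
        have : a ≠ 1 := fun ha => hn (by simp [ha])
        omega
      refine ⟨s₁ ++ 1 :: s₂, ?_, rfl⟩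
      rw [Finset.mem_erase, mem_binaryWords]
      refine ⟨fun he => ?_, fun x hx => h x (List.mem_cons_of_mem _ hx), ?_, ?_⟩
      · have hp : (s₁ ++ 1 :: s₂).Pairwise (· ≤ ·) := by
          rw [he, List.pairwise_append]
          refine ⟨?_, ?_, ?_⟩
          · simp [List.pairwise_replicate]
          · simp [List.pairwise_replicate]
          · intro x hx y hy
            rw [List.eq_of_mem_replicate hx]
            exact Nat.zero_le _
        have := (List.pairwise_cons.1 (List.pairwise_append.1 hp).2.1).1 0 m2
        omega
      · simpa using h0
      · simpa using h1
  · rintro ⟨s', hs', rfl⟩ -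
    obtain ⟨s₁, s₂, he, hn⟩ := List.eq_append_cons_of_mem hmem
    cases s₁ with
    | nil => simp at he
    | cons a s₁ =>
      obtain ⟨rfl, rfl⟩ : 0 = a ∧ s' = s₁ ++ 1 :: s₂ := by simpa using he
      refine ⟨0 :: s₁, s₂, he, hn, by simp, ?_⟩
      by_contra hz
      rw [Finset.mem_erase] at hs'
      refine hs'.1 ?_
      have e1 : s₁ = List.replicate s₁.length 0 := by
        refine List.eq_replicate_iff.2 ⟨rfl, fun x hx => ?_⟩
        have := h x (by simp [hx])
        have : x ≠ 1 := fun hx1 => hn (by simp [← hx1, hx])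
        omega
      have e2 : s₂ = List.replicate s₂.length 1 := by
        refine List.eq_replicate_iff.2 ⟨rfl, fun x hx => ?_⟩
        have := h x (by simp [hx])
        have : x ≠ 0 := fun hx1 => hz (by simp [← hx1, hx])
        omega
      have c1 : s₁.length = t := by
        rw [e1, e2] at h0
        simpa [List.count_replicate] using h0
      have c2 : s₂.length = b := by
        rw [e1, e2] at h1
        simpa [List.count_replicate] using h1
      rw [e1, e2, c1, c2]
      simp [List.replicate_succ]

theorem card_enclosed_binary (t b : ℕ) :
    Nat.card {s // s ∈ binaryWords (t + 1) (b + 1) ∧ Enclosed 0 s} = shuffleCount t b := by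
  have e : {s | s ∈ binaryWords (t + 1) (b + 1) ∧ Enclosed 0 s} =
      (((binaryWords t (b + 1)).erase (List.replicate t 0 ++ List.replicate (b + 1) 1)).map
        ⟨List.cons 0, List.cons_injective⟩ : Finset (List ℕ)) := by
    ext s
    rw [Finset.mem_coe, Finset.mem_map]
    constructor
    · exact fun h => (enclosed_zero_binary_iff h.1).1 h.2
    · intro h
      have hs : s ∈ binaryWords (t + 1) (b + 1) := by
        obtain ⟨s', hs', rfl⟩ := h
        have := mem_binaryWords.1 (Finset.mem_of_mem_erase hs')
        rw [mem_binaryWords]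
        simpa using this
      exact ⟨hs, (enclosed_zero_binary_iff hs).2 h⟩
  change Nat.card {s | s ∈ binaryWords (t + 1) (b + 1) ∧ Enclosed 0 s} = _
  rw [e, Nat.card_coe_set_eq, Set.ncard_coe_finset, Finset.card_map, Finset.card_erase_of_mem,
    card_binaryWords, shuffleCount, add_assoc]
  rw [mem_binaryWords]
  refine ⟨fun x hx => ?_, by simp [List.count_replicate], by simp [List.count_replicate]⟩
  rw [List.mem_append] at hx
  rcases hx with hx | hx <;> simp [List.eq_of_mem_replicate hx]

theorem card_enclosed_binary_zero (t : ℕ) :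
    Nat.card {s // s ∈ binaryWords (t + 1) 0 ∧ Enclosed 0 s} = 1 := by
  rw [Nat.card_eq_one_iff_unique]
  refine ⟨⟨fun a b => Subtype.ext ?_⟩, ⟨⟨List.replicate (t + 1) 0, by simp [binaryWords], ?_⟩⟩⟩
  · have ha := a.2.1
    have hb := b.2.1
    simp only [binaryWords, Finset.mem_singleton] at ha hb
    rw [ha, hb]
  · intro h
    exact absurd (List.eq_of_mem_replicate h) (by simp)

end Binary

section Counting

theorem isCatalanWord_getElem (l : List ℕ) :
    IsCatalanWord (fun i : Fin l.length => l[i]) ↔ IsCatalanList l := by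
  refine and_congr ?_ ⟨fun h k hk => ?_, fun h i hi hf => ?_⟩
  · rw [List.isChain_iff_getElem]
    constructor
    · intro h i hi
      exact h ⟨i, by omega⟩ ⟨i + 1, hi⟩ rfl
    · rintro h ⟨i, hi⟩ ⟨j, hj⟩ hij
      obtain rfl : j = i + 1 := hij
      exact h i hj
  · obtain ⟨l₁, l₂, rfl, hn⟩ := List.eq_append_cons_of_mem hk
    obtain ⟨⟨i₁, hi₁⟩, ⟨i₂, hi₂⟩, h1, h2, e1, e2⟩ := h ⟨l₁.length, by simp⟩ (by simp) (by
      rintro ⟨j, hj⟩ hlt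
      have hlt : j < l₁.length := hlt
      intro he
      simp [List.getElem_append_left hlt] at he
      exact hn (he ▸ List.getElem_mem hlt))
    have h1 : i₁ < l₁.length := h1
    have h2 : l₁.length < i₂ := h2
    refine ⟨l₁, l₂, rfl, hn, ?_, ?_⟩
    · simp [List.getElem_append_left h1] at e1
      exact e1 ▸ List.getElem_mem h1
    · obtain ⟨d, rfl⟩ : ∃ d, i₂ = l₁.length + (d + 1) := ⟨i₂ - l₁.length - 1, by omega⟩
      simp at e2
      exact e2 ▸ List.getElem_mem _
  · obtain ⟨i, hi'⟩ := i
    obtain ⟨k, hk⟩ : ∃ k, l[i] = k + 1 := ⟨l[i] - 1, by have : 0 < l[i] := hi; omega⟩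
    obtain ⟨l₁, l₂, rfl, hn, m1, m2⟩ := h k (hk ▸ List.getElem_mem hi')
    have hii : i = l₁.length := by
      rcases lt_trichotomy i l₁.length with h | h | h
      · rw [List.getElem_append_left h] at hk
        exact absurd (hk ▸ List.getElem_mem h) hn
      · exact h
      · exact absurd (by simp [hk]) (hf ⟨l₁.length, by simp⟩ h)
    obtain ⟨i₁, h1, e1⟩ := List.mem_iff_getElem.1 m1
    obtain ⟨i₂, h2, e2⟩ := List.mem_iff_getElem.1 m2
    subst hii
    refine ⟨⟨i₁, by simp; omega⟩, ⟨l₁.length + (i₂ + 1), by simp; omega⟩, h1,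
      show l₁.length < l₁.length + (i₂ + 1) by omega, ?_, ?_⟩
    · simp [List.getElem_append_left h1, e1]
    · simp [e2]

theorem occ_getElem (l : List ℕ) (k : ℕ) : occ (fun i : Fin l.length => l[i]) k = l.count k := by
  rw [occ, Finset.card_filter]
  have h : l.count k = (l.map fun a => if a = k then 1 else 0).sum := by
    induction l with
    | nil => rfl
    | cons a l ih => by_cases h : a = k <;> simp [h, ih, add_comm]
  rw [h, ← Fin.sum_univ_fun_getElem]
  rfl

/-- The number of Catalan words of length `n` with `t` zeros and the property `P`. -/
noncomputable def countWords (P : List ℕ → Prop) (n t : ℕ) : ℕ :=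
  Nat.card {l : List ℕ // IsCatalanList l ∧ l.length = n ∧ l.count 0 = t ∧ P l}

theorem bijective_getElem {n : ℕ} (Q : (Fin n → ℕ) → Prop) :
    Function.Bijective (fun l : {l : List ℕ // ∃ h : l.length = n, Q fun i => l[i]} =>
      (⟨fun i => l.1[(i : ℕ)]'(by rw [l.2.1]; exact i.2), l.2.2⟩ : {a : Fin n → ℕ // Q a})) := by
  constructor
  · rintro ⟨l, hl, h⟩ ⟨l', hl', h'⟩ he
    refine Subtype.ext (List.ext_getElem (hl.trans hl'.symm) fun i hi _ => ?_)
    exact congrFun (congrArg Subtype.val he) ⟨i, hl ▸ hi⟩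
  · rintro ⟨a, ha⟩
    exact ⟨⟨List.ofFn a, by simp, by simpa using ha⟩, by simp⟩

theorem finite_isCatalanList (n : ℕ) : {l : List ℕ | IsCatalanList l ∧ l.length = n}.Finite := by
  have : Finite {a : Fin n → ℕ // IsCatalanWord a} := finite_isCatalanWord n
  refine Set.Finite.subset (s := {l : List ℕ | ∃ h : l.length = n,
    IsCatalanWord fun i : Fin n => l[i]})
    (Finite.of_injective _ (bijective_getElem (n := n) IsCatalanWord).1) ?_
  rintro l ⟨h, rfl⟩
  exact ⟨rfl, (isCatalanWord_getElem l).2 h⟩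

theorem numWords_eq_countWords (i n s t : ℕ) :
    numWords i n s t = countWords (fun l => l.count i = s) n t := by
  rw [numWords, ← Nat.card_coe_set_eq, countWords]
  refine (Nat.card_eq_of_bijective _ (bijective_getElem (n := n)
    (fun a => IsCatalanWord a ∧ occ a i = s ∧ occ a 0 = t))).symm.trans
    (Nat.card_congr (Equiv.subtypeEquivRight fun l => ?_))
  constructor
  · rintro ⟨rfl, h1, h2, h3⟩
    exact ⟨(isCatalanWord_getElem l).1 h1, rfl, (occ_getElem l 0).symm.trans h3,
      (occ_getElem l i).symm.trans h2⟩
  · rintro ⟨h1, rfl, h3, h2⟩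
    exact ⟨rfl, (isCatalanWord_getElem l).2 h1, (occ_getElem l i).trans h2,
      (occ_getElem l 0).trans h3⟩

instance (P : List ℕ → Prop) (n t : ℕ) :
    Finite {l : List ℕ // IsCatalanList l ∧ l.length = n ∧ l.count 0 = t ∧ P l} :=
  (finite_isCatalanList n).subset fun _ h => ⟨h.1, h.2.1⟩

instance (t b : ℕ) : Finite {s // s ∈ binaryWords t b ∧ Enclosed 0 s} :=
  (binaryWords t b).finite_toSet.subset fun _ h => h.1

/-- Removing the zeros from a word. -/
theorem countWords_add {P P' : List ℕ → Prop} (hP : ∀ l, P l ↔ P' (high l)) (m t : ℕ) :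
    countWords P (m + t) t = ∑ b ∈ Finset.range (m + 1),
      Nat.card {s // s ∈ binaryWords t b ∧ Enclosed 0 s} * countWords P' m b := by
  rw [← Fin.sum_univ_eq_sum_range
    (fun b => Nat.card {s // s ∈ binaryWords t b ∧ Enclosed 0 s} * countWords P' m b)]
  simp only [countWords, ← Nat.card_prod]
  rw [← Nat.card_sigma]
  symm
  have key : ∀ {b : ℕ} {s r : List ℕ}, s ∈ binaryWords t b → Enclosed 0 s →
      IsCatalanList r → r.length = m → r.count 0 = b → P' r →
      IsCatalanList (merge s r) ∧ (merge s r).length = m + t ∧ (merge s r).count 0 = t ∧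
        P (merge s r) ∧ low (merge s r) = s ∧ high (merge s r) = r := by
    intro b s r hs hE hr hm hb hP'
    obtain ⟨h, h0, h1⟩ := mem_binaryWords.1 hs
    have hc : s.count 1 = r.count 0 := h1.trans hb.symm
    have e1 := low_merge h hc
    have e2 := high_merge h hc
    have e0 : (merge s r).count 0 = t := by rw [← count_low_zero, e1, h0]
    refine ⟨isCatalanList_merge h hc hE hr, ?_, e0, ?_, e1, e2⟩
    · rw [← length_high, e2, e0, hm]
    · rwa [hP, e2]
  refine Nat.card_eq_of_bijective (fun x => ⟨merge x.2.1.1 x.2.2.1, ?_⟩) ⟨?_, ?_⟩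
  · obtain ⟨b, ⟨s, hs, hE⟩, ⟨r, h1, h2, h3, h4⟩⟩ := x
    have := key hs hE h1 h2 h3 h4
    exact ⟨this.1, this.2.1, this.2.2.1, this.2.2.2.1⟩
  · rintro ⟨⟨b, hb⟩, ⟨s, hs, hE⟩, ⟨r, h1, h2, h3, h4⟩⟩ ⟨⟨b', hb'⟩, ⟨s', hs', hE'⟩,
      ⟨r', h1', h2', h3', h4'⟩⟩ he
    have he : merge s r = merge s' r' := congrArg Subtype.val he
    obtain ⟨-, -, -, -, e1, e2⟩ := key hs hE h1 h2 h3 h4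
    obtain ⟨-, -, -, -, e1', e2'⟩ := key hs' hE' h1' h2' h3' h4'
    obtain rfl : s = s' := by rw [← e1, ← e1', he]
    obtain rfl : r = r' := by rw [← e2, ← e2', he]
    obtain rfl : b = b' := h3.symm.trans h3'
    rfl
  · rintro ⟨l, h1, h2, h3, h4⟩
    have hl : (high l).length = m := by have := length_high l; omega
    refine ⟨⟨⟨(high l).count 0, ?_⟩, ⟨low l, ?_, ?_⟩, ⟨high l, h1.high, hl, rfl, (hP l).1 h4⟩⟩,
      Subtype.ext (merge_low_high h1.1)⟩
    · have := List.count_le_length (a := 0) (l := high l)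
      omega
    · exact mem_binaryWords.2 ⟨by simp [low], (count_low_zero l).trans h3,
        (count_low_one l).trans (count_high 0 l).symm⟩
    · exact enclosed_zero_low.2 (h1.2 0)

theorem countWords_zero (P : List ℕ → Prop) [Decidable (P [])] (m : ℕ) :
    countWords P m 0 = if m = 0 ∧ P [] then 1 else 0 := by
  split_ifs with h
  · rw [countWords, Nat.card_eq_one_iff_unique]
    refine ⟨⟨fun a b => Subtype.ext ?_⟩, ⟨⟨[], ⟨by simp, fun k hk => by simp at hk⟩, by simp [h.1],
      by simp, h.2⟩⟩⟩
    rw [a.2.1.eq_nil a.2.2.2.1, b.2.1.eq_nil b.2.2.2.1]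
  · rw [countWords, Nat.card_eq_zero]
    refine Or.inl ⟨fun a => h ?_⟩
    have hn := a.2.1.eq_nil a.2.2.2.1
    have := a.2.2
    rw [hn] at this
    exact ⟨this.1.symm, this.2.2⟩

/-- The transfer recursion for the numbers of words. -/
theorem countWords_add_succ {P P' : List ℕ → Prop} [Decidable (P' [])]
    (hP : ∀ l, P l ↔ P' (high l)) (m t : ℕ) :
    countWords P (m + (t + 1)) (t + 1) = (if m = 0 ∧ P' [] then 1 else 0) +
      ∑ b ∈ Finset.range m, shuffleCount t b * countWords P' m (b + 1) := by
  rw [countWords_add hP, Finset.sum_range_succ', add_comm, card_enclosed_binary_zero, one_mul,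
    countWords_zero]
  simp only [card_enclosed_binary]

theorem countWords_eq_zero {P : List ℕ → Prop} {n t : ℕ}
    (h : ∀ l : List ℕ, l.length = n → l.count 0 = t → ¬ P l) : countWords P n t = 0 := by
  rw [countWords, Nat.card_eq_zero]
  exact Or.inl ⟨fun a => h a.1 a.2.2.1 a.2.2.2.1 a.2.2.2.2⟩

end Counting

section Series

open PowerSeries Finset

variable {F : Type*} [Field F]

/-- The series `∑_n x^{n-t-1} ∑_s a_i(n,s,t+1) v^s`. -/
noncomputable def tailSeries (v : F) (i t : ℕ) : F⟦X⟧ :=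
  PowerSeries.mk fun m => ∑ s ∈ Icc 1 (m + (t + 1)), (numWords i (m + (t + 1)) s (t + 1) : F) * v ^ s

/-- The series `∑_n x^{n-t-1}` times the number of words of length `n` with `t + 1` zeros. -/
noncomputable def zeroSeries (F : Type*) [Field F] (t : ℕ) : F⟦X⟧ :=
  PowerSeries.mk fun m => (countWords (fun _ => True) (m + (t + 1)) (t + 1) : F)

theorem coeff_transfer (K : ℕ → F⟦X⟧) (a : ℕ → F) (m N : ℕ) (hN : m < N) (c : ℕ → ℕ → F)
    (hK : ∀ b m, coeff m (K b) = c b (m + (b + 1))) :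
    coeff m (∑ b ∈ range N, (PowerSeries.C (a b)) * (X ^ (b + 1) * K b)) =
      ∑ b ∈ range m, a b * c b m := by
  rw [map_sum]
  simp only [coeff_C_mul, coeff_X_pow_mul', hK]
  rw [← Finset.sum_subset (Finset.range_subset_range.2 hN.le)]
  · refine Finset.sum_congr rfl fun b hb => ?_
    have : b + 1 ≤ m := by simpa using hb
    rw [if_pos this, Nat.sub_add_cancel this]
  · intro b _ hb
    have : ¬ b + 1 ≤ m := by simpa using hb
    rw [if_neg this, mul_zero]

theorem natCast_eq_C (n : ℕ) : (n : F⟦X⟧) = PowerSeries.C (n : F) := (map_natCast _ n).symm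

theorem zeroSeries_sumsTo (t : ℕ) :
    SumsTo (fun b => (shuffleCount t b : F⟦X⟧) * (X ^ (b + 1) * zeroSeries F b))
      (zeroSeries F t - 1) := by
  intro N
  rw [X_pow_dvd_iff]
  intro m hm
  simp only [natCast_eq_C]
  rw [map_sub, coeff_transfer (zeroSeries F) (fun b => (shuffleCount t b : F)) m N hm
    (fun b n => (countWords (fun _ => True) n (b + 1) : F)) (fun b m => by rw [zeroSeries, coeff_mk]),
    map_sub, zeroSeries, coeff_mk,
    countWords_add_succ (P' := fun _ => True) (fun _ => Iff.rfl), coeff_one]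
  by_cases h : m = 0 <;> simp [h]

theorem zeroSeries_eq (t : ℕ) : zeroSeries F t = catalanF F ^ t :=
  eq_catalanF_pow zeroSeries_sumsTo t

theorem tailSeries_zero (v : F) (t : ℕ) :
    tailSeries v 0 t = PowerSeries.C v ^ (t + 1) * catalanF F ^ t := by
  rw [← zeroSeries_eq]
  ext m
  rw [← map_pow, coeff_C_mul, tailSeries, zeroSeries, coeff_mk, coeff_mk,
    Finset.sum_eq_single (t + 1), numWords_eq_countWords, mul_comm]
  · congr 2
    refine Nat.card_congr (Equiv.subtypeEquivRight fun l => ?_)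
    tauto
  · intro s _ hs
    rw [numWords_eq_countWords, countWords_eq_zero, Nat.cast_zero, zero_mul]
    intro l _ h h'
    exact hs (h'.symm.trans h)
  · intro h
    exact absurd (Finset.mem_Icc.2 ⟨by omega, by omega⟩) h

theorem tailSeries_sumsTo (v : F) (i t : ℕ) :
    SumsTo (fun b => (shuffleCount t b : F⟦X⟧) * (X ^ (b + 1) * tailSeries v i b))
      (tailSeries v (i + 1) t) := by
  intro N
  rw [X_pow_dvd_iff]
  intro m hm
  simp only [natCast_eq_C]
  rw [map_sub, coeff_transfer (tailSeries v i) (fun b => (shuffleCount t b : F)) m N hm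
    (fun b n => ∑ s ∈ Icc 1 n, (numWords i n s (b + 1) : F) * v ^ s)
    (fun b m => by rw [tailSeries, coeff_mk]), tailSeries, coeff_mk, sub_eq_zero]
  have h1 : ∀ s ∈ Icc 1 (m + (t + 1)), (numWords (i + 1) (m + (t + 1)) s (t + 1) : F) * v ^ s =
      ∑ b ∈ range m, shuffleCount t b * ((numWords i m s (b + 1) : F) * v ^ s) := by
    intro s hs
    have hs1 : s ≠ 0 := by have := (Finset.mem_Icc.1 hs).1; omega
    rw [numWords_eq_countWords, countWords_add_succ (P' := fun l => l.count i = s)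
      (fun l => by rw [count_high])]
    simp only [List.count_nil, hs1.symm, and_false, if_false, zero_add]
    rw [Nat.cast_sum, Finset.sum_mul]
    refine Finset.sum_congr rfl fun b _ => ?_
    rw [numWords_eq_countWords, Nat.cast_mul, mul_assoc]
  rw [Finset.sum_congr rfl h1, Finset.sum_comm]
  refine Finset.sum_congr rfl fun b _ => ?_
  rw [← Finset.mul_sum]
  congr 1
  symm
  refine Finset.sum_subset (Finset.Icc_subset_Icc_right (by omega)) fun s hs hs' => ?_
  rw [numWords_eq_countWords, countWords_eq_zero, Nat.cast_zero, zero_mul]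
  intro l hl _ h
  have := List.count_le_length (a := i) (l := l)
  simp only [Finset.mem_Icc] at hs hs'
  omega

theorem letterSeries_eq_evalAt (w v : F) (i : ℕ) :
    letterSeries w v i = evalAt (tailSeries v i) (PowerSeries.C w) := by
  ext n
  rw [letterSeries, evalAt, coeff_mk, coeff_mk, Finset.sum_comm, Finset.sum_range_succ]
  have h0 : coeff n ((X * PowerSeries.C w) ^ (n + 1) * tailSeries v i n) = 0 := by
    refine X_pow_dvd_iff.1 (Dvd.dvd.mul_right ?_ _) n (Nat.lt_succ_self n)
    rw [mul_pow]
    exact dvd_mul_right _ _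
  rw [h0, add_zero]
  refine Finset.sum_nbij' (fun t => t - 1) (fun t => t + 1) ?_ ?_ ?_ ?_ ?_
  · intro t ht; simp only [Finset.mem_Icc, Finset.mem_range] at ht ⊢; omega
  · intro t ht; simp only [Finset.mem_Icc, Finset.mem_range] at ht ⊢; omega
  · intro t ht; simp only [Finset.mem_Icc] at ht; omega
  · intro t _; rfl
  · intro t ht
    rw [Finset.mem_Icc] at ht
    obtain ⟨t, rfl⟩ : ∃ t', t = t' + 1 := ⟨t - 1, by omega⟩
    rw [Nat.add_sub_cancel, mul_pow, mul_assoc, coeff_X_pow_mul', if_pos ht.2, ← map_pow,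
      coeff_C_mul, tailSeries, coeff_mk, Nat.sub_add_cancel ht.2, Finset.mul_sum]
    refine Finset.sum_congr rfl fun s _ => ?_
    ring

end Series

section LaurentField

variable {F : Type*} [Field F]

/-- The ring homomorphism underlying `inX`. -/
noncomputable def inXHom : F⟦X⟧ →+* F⸨X⸩ :=
  (HahnSeries.ofPowerSeries ℤ F).comp (PowerSeries.expand 2 two_ne_zero).toRingHom

theorem inXHom_X : inXHom (PowerSeries.X : F⟦X⟧) = x := by
  change HahnSeries.ofPowerSeries ℤ F (PowerSeries.expand 2 two_ne_zero PowerSeries.X) = x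
  rw [PowerSeries.expand_X, map_pow, HahnSeries.ofPowerSeries_X, x, sqrtX]

theorem inXHom_C (a : F) : inXHom (PowerSeries.C a) = const a := by
  change HahnSeries.ofPowerSeries ℤ F (PowerSeries.expand 2 two_ne_zero (PowerSeries.C a)) = _
  rw [PowerSeries.expand_C, HahnSeries.ofPowerSeries_C, const]

theorem sqrtX_ne_zero : (sqrtX : F⸨X⸩) ≠ 0 := HahnSeries.single_ne_zero one_ne_zero

/-- `1 / (1 - x u)` for a power series `u`. -/
noncomputable def geom (u : F⟦X⟧) : F⟦X⟧ := (1 - PowerSeries.X * u)⁻¹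

theorem geom_mul (u : F⟦X⟧) : geom u * (1 - PowerSeries.X * u) = 1 :=
  PowerSeries.inv_mul_cancel _ (by simp)

theorem one_sub_x_mul_ne_zero (u : F⟦X⟧) : 1 - x * inXHom u ≠ 0 := by
  intro h
  have := congrArg inXHom (geom_mul u)
  rw [map_mul, map_sub, map_mul, inXHom_X, map_one, h, mul_zero] at this
  exact zero_ne_one this

theorem inXHom_geom (u : F⟦X⟧) : inXHom (geom u) = 1 / (1 - x * inXHom u) := by
  rw [eq_div_iff (one_sub_x_mul_ne_zero u)]
  have := congrArg inXHom (geom_mul u)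
  rwa [map_mul, map_sub, map_mul, inXHom_X, map_one] at this

/-- The sequence `w, L_0(x,w), L_1(x,w), …` as power series. -/
noncomputable def levels (w : F) (j : ℕ) : F⟦X⟧ := geom^[j] (PowerSeries.C w)

theorem levels_succ (w : F) (j : ℕ) : levels w (j + 1) = geom (levels w j) :=
  Function.iterate_succ_apply' _ _ _

theorem inXHom_levels_zero (w : F) : inXHom (levels w 0) = const w := inXHom_C w

theorem inXHom_levels_succ (w : F) (j : ℕ) : inXHom (levels w (j + 1)) = L w j := by
  induction j with
  | zero => rw [levels_succ, inXHom_geom, inXHom_levels_zero, L]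
  | succ j ih => rw [levels_succ, inXHom_geom, ih, L]

/-- `A_i(x, w, v)` with a power series substituted for `w`. -/
noncomputable def letterAt (v : F) (i : ℕ) (u : F⟦X⟧) : F⸨X⸩ :=
  inXHom (evalAt (tailSeries v i) u)

theorem letterAt_succ (v : F) (i : ℕ) (u : F⟦X⟧) :
    letterAt v (i + 1) u =
      x * inXHom u * inXHom (geom u) * (letterAt v i (geom u) - letterAt v i 1) := by
  rw [letterAt, evalAt_transfer (tailSeries_sumsTo v i) (geom_mul u)]
  simp only [map_mul, map_sub, inXHom_X, letterAt]

theorem letterAt_zero (v : F) (u : F⟦X⟧) : letterAt v 0 u = A₂ (const v * inXHom u) := by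
  have h : tailSeries v 0 = fun t => PowerSeries.C v ^ (t + 1) * catalanF F ^ t :=
    funext (tailSeries_zero v)
  have hz := geom_mul (u * PowerSeries.C v * catalanF F)
  have hne := one_sub_x_mul_ne_zero (u * PowerSeries.C v * catalanF F)
  rw [letterAt, h, evalAt_geometric (PowerSeries.C v) u (catalanF F)
    (geom (u * PowerSeries.C v * catalanF F)) (by linear_combination hz)]
  simp only [map_mul, inXHom_X, inXHom_geom, inXHom_C] at hne ⊢
  have hc : (catalanC : F⸨X⸩) = inXHom (catalanF F) := rfl
  rw [A₂, hc]
  have hd : 1 - x * (const v * inXHom u) * inXHom (catalanF F) =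
      1 - x * (inXHom u * const v * inXHom (catalanF F)) := by ring
  rw [hd]
  ring

/-- `U_j(t) - w √x U_{j-1}(t)`. -/
noncomputable def den (w : F) (j : ℤ) : F⸨X⸩ := chebU j - const w * sqrtX * chebU (j - 1)

theorem sqrtX_mul_chebU [CharZero F] (j : ℤ) :
    sqrtX * chebU (j + 2) = (chebU (j + 1) - sqrtX * chebU j : F⸨X⸩) := by
  have h2 : (2 : F⸨X⸩) ≠ 0 := by
    have h : (HahnSeries.C 2 : F⸨X⸩) ≠ 0 := (map_ne_zero HahnSeries.C).2 two_ne_zero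
    rwa [map_ofNat] at h
  rw [chebU, Polynomial.Chebyshev.U_add_two, chebU, chebU]
  simp only [Polynomial.eval_sub, Polynomial.eval_mul, Polynomial.eval_X, Polynomial.eval_ofNat]
  have := sqrtX_ne_zero (F := F)
  field_simp

theorem chebU_zero : (chebU 0 : F⸨X⸩) = 1 := by simp [chebU]

theorem chebU_neg_one : (chebU (-1) : F⸨X⸩) = 0 := by simp [chebU]

theorem sqrtX_mul_den [CharZero F] (w : F) (j : ℤ) :
    sqrtX * den w (j + 2) = den w (j + 1) - sqrtX * den w j := by
  have h1 := sqrtX_mul_chebU (F := F) j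
  have h2 := sqrtX_mul_chebU (F := F) (j - 1)
  rw [show j - 1 + 2 = j + 1 by ring, show j - 1 + 1 = j by ring] at h2
  rw [den, den, den, show j + 2 - 1 = j + 1 by ring, show j + 1 - 1 = j by ring]
  linear_combination h1 - const w * sqrtX * h2

theorem den_zero (w : F) : den w 0 = 1 := by
  rw [den, chebU_zero, zero_sub, chebU_neg_one, mul_zero, sub_zero]

theorem sqrtX_mul_den_one [CharZero F] (w : F) : sqrtX * den w 1 = 1 - x * const w := by
  have h := sqrtX_mul_chebU (F := F) (-1)
  rw [show (-1 : ℤ) + 2 = 1 by norm_num, show (-1 : ℤ) + 1 = 0 by norm_num, chebU_zero,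
    chebU_neg_one] at h
  rw [den, sub_self, chebU_zero, x]
  linear_combination h

theorem den_ne_zero_and_L [CharZero F] (w : F) (j : ℕ) :
    den w j ≠ 0 ∧ den w (j + 1) ≠ 0 ∧ L w j = den w j / (sqrtX * den w (j + 1)) := by
  have hs := sqrtX_ne_zero (F := F)
  induction j with
  | zero =>
    have h1 := one_sub_x_mul_ne_zero (levels w 0)
    rw [inXHom_levels_zero, ← sqrtX_mul_den_one] at h1
    rw [Nat.cast_zero, den_zero, zero_add, sqrtX_mul_den_one, L]
    exact ⟨one_ne_zero, right_ne_zero_of_mul h1, rfl⟩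
  | succ j ih =>
    obtain ⟨h0, h1, hL⟩ := ih
    have h2 := one_sub_x_mul_ne_zero (levels w (j + 1))
    have hrec := sqrtX_mul_den w j
    have key : (1 - x * L w j) * den w (j + 1) = sqrtX * den w (j + 2) := by
      rw [hrec, hL, x]
      field_simp
    rw [inXHom_levels_succ] at h2
    have h3 : sqrtX * den w (j + 2) ≠ 0 := key ▸ mul_ne_zero h2 h1
    push_cast
    rw [show (j : ℤ) + 1 + 1 = j + 2 by ring]
    refine ⟨h1, right_ne_zero_of_mul h3, ?_⟩
    rw [L, ← key]
    field_simp

theorem den_ne_zero [CharZero F] (w : F) (j : ℕ) : den w j ≠ 0 := (den_ne_zero_and_L w j).1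

/-- `w √x / ((U_{j+1} - w √x U_j)(U_j - w √x U_{j-1}))`. -/
noncomputable def weight (w : F) (j : ℕ) : F⸨X⸩ :=
  const w * sqrtX / (den w (j + 1) * den w j)

theorem weight_zero [CharZero F] (w : F) :
    weight w 0 = x * inXHom (levels w 0) * inXHom (levels w 1) := by
  obtain ⟨-, h1, hL⟩ := den_ne_zero_and_L w 0
  have hs := sqrtX_ne_zero (F := F)
  rw [inXHom_levels_zero, inXHom_levels_succ, hL, weight, x, Nat.cast_zero, den_zero]
  rw [Nat.cast_zero] at h1
  field_simp

theorem weight_succ [CharZero F] (w : F) (j : ℕ) :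
    weight w (j + 1) =
      weight w j * (x * inXHom (levels w (j + 1)) * inXHom (levels w (j + 2))) := by
  have hs := sqrtX_ne_zero (F := F)
  obtain ⟨h0, h1, hL⟩ := den_ne_zero_and_L w j
  obtain ⟨-, h2, hL'⟩ := den_ne_zero_and_L w (j + 1)
  rw [inXHom_levels_succ, inXHom_levels_succ, hL, hL', weight, weight, x]
  push_cast at *
  field_simp

theorem weight_one [CharZero F] (j : ℕ) :
    weight (1 : F) j = 1 / (sqrtX * chebU (j + 2) * chebU (j + 1)) := by
  have hs := sqrtX_ne_zero (F := F)
  have e : ∀ j : ℤ, den (1 : F) j = sqrtX * chebU (j + 1) := by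
    intro j
    have h := sqrtX_mul_chebU (F := F) (j - 1)
    rw [show j - 1 + 2 = j + 1 by ring, show j - 1 + 1 = j by ring] at h
    rw [h, den, const, map_one, one_mul]
  have h1 := den_ne_zero (1 : F) j
  have h2 := den_ne_zero (1 : F) (j + 1)
  push_cast at h2
  rw [e] at h1 h2
  rw [weight, e, e, const, map_one, one_mul, show (j : ℤ) + 1 + 1 = j + 2 by ring] at *
  have h1 := right_ne_zero_of_mul h1
  have h2 := right_ne_zero_of_mul h2
  field_simp

/-- The `n`-fold iterate of `letterAt_succ`, starting from `w`. -/
theorem letterAt_iterate [CharZero F] (w v : F) (i j : ℕ) :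
    letterAt v (i + (j + 1)) (levels w 0) = weight w j * letterAt v i (levels w (j + 1)) -
      ∑ k ∈ Finset.range (j + 1), weight w k * letterAt v (i + j - k) 1 := by
  induction j generalizing i with
  | zero =>
    rw [zero_add, letterAt_succ, ← levels_succ, ← weight_zero, Finset.sum_range_one, add_zero,
      Nat.sub_zero, mul_sub]
  | succ j ih =>
    rw [show i + (j + 1 + 1) = i + 1 + (j + 1) by ring, ih, letterAt_succ, ← levels_succ,
      Finset.sum_range_succ _ (j + 1), weight_succ, show i + (j + 1) - (j + 1) = i by omega,
      show i + 1 + j = i + (j + 1) by ring]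
    ring

theorem letterAt_levels_zero (w v : F) (i : ℕ) :
    letterAt v i (levels w 0) = inX (letterSeries w v i) := by
  rw [letterSeries_eq_evalAt]; rfl

theorem levels_one_zero : levels (1 : F) 0 = 1 := map_one _

theorem coeff_fullSeries_succ (w v : F) (i : ℕ) :
    PowerSeries.coeff (i + 1) (fullSeries w v) = letterAt v (i + 1) (levels w 0) := by
  rw [fullSeries, PowerSeries.coeff_mk, if_neg (Nat.succ_ne_zero i), letterAt_levels_zero]

theorem coeff_fullSeries_zero (w v : F) : PowerSeries.coeff 0 (fullSeries w v) = 0 := by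
  rw [fullSeries, PowerSeries.coeff_mk, if_pos rfl]

/-- The coefficients of `A(x,w,v,q)` in terms of those of `A(x,1,v,q)`. -/
theorem coeff_fullSeries_eq_sum [CharZero F] (w v : F) (i : ℕ) :
    PowerSeries.coeff (i + 1) (fullSeries w v) = ∑ k ∈ Finset.range (i + 1), weight w k *
      PowerSeries.coeff (i - k)
        (PowerSeries.C (A₂ (const v * L w k) - A₂ (const v)) - fullSeries 1 v) := by
  have h := letterAt_iterate w v 0 i
  rw [zero_add] at h
  rw [coeff_fullSeries_succ, h, zero_add, Finset.sum_range_succ, Finset.sum_range_succ,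
    Nat.sub_self, map_sub, coeff_fullSeries_zero, letterAt_zero, letterAt_zero, inXHom_levels_succ,
    map_one, mul_one, PowerSeries.coeff_zero_C]
  have e : ∀ k ∈ Finset.range i, weight w k * PowerSeries.coeff (i - k)
        (PowerSeries.C (A₂ (const v * L w k) - A₂ (const v)) - fullSeries 1 v) =
      -(weight w k * letterAt v (i - k) 1) := by
    intro k hk
    obtain ⟨d, hd⟩ : ∃ d, i - k = d + 1 := ⟨i - k - 1, by
      have := Finset.mem_range.1 hk; omega⟩
    rw [hd, map_sub, coeff_fullSeries_succ, PowerSeries.coeff_C, if_neg (Nat.succ_ne_zero d),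
      levels_one_zero]
    ring
  rw [Finset.sum_congr rfl e, Finset.sum_neg_distrib]
  ring

theorem fullSeries_one [CharZero F] (v : F) :
    fullSeries 1 v = q * numerSeries v * (1 + q * denomSeries)⁻¹ := by
  rw [PowerSeries.eq_mul_inv_iff_mul_eq (by simp [q])]
  ext n
  cases n with
  | zero =>
    have h := coeff_fullSeries_zero (1 : F) v
    rw [PowerSeries.coeff_zero_eq_constantCoeff_apply] at h
    simp [q, h]
  | succ i =>
    have e1 : fullSeries 1 v * (1 + q * denomSeries) =
        fullSeries 1 v + q * (denomSeries * fullSeries 1 v) := by ring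
    rw [e1, map_add, q, PowerSeries.coeff_succ_X_mul, PowerSeries.coeff_succ_X_mul,
      coeff_fullSeries_eq_sum, PowerSeries.coeff_mul, Finset.Nat.sum_antidiagonal_eq_sum_range_succ_mk,
      ← Finset.sum_add_distrib]
    have e2 : ∀ k, weight (1 : F) k * PowerSeries.coeff (i - k)
          (PowerSeries.C (A₂ (const v * L 1 k) - A₂ (const v)) - fullSeries 1 v) +
        PowerSeries.coeff k denomSeries * PowerSeries.coeff (i - k) (fullSeries 1 v) =
        weight 1 k * PowerSeries.coeff (i - k)
          (PowerSeries.C (A₂ (const v * L 1 k) - A₂ (const v))) := by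
      intro k
      rw [denomSeries, PowerSeries.coeff_mk, ← weight_one, map_sub]
      ring
    simp only [e2]
    rw [Finset.sum_range_succ, Finset.sum_eq_zero, zero_add, Nat.sub_self, PowerSeries.coeff_zero_C,
      numerSeries, PowerSeries.coeff_mk, weight_one]
    · rw [div_mul_eq_mul_div, one_mul]
    · intro k hk
      have := Finset.mem_range.1 hk
      rw [PowerSeries.coeff_C, if_neg (by omega), mul_zero]

end LaurentField

end CatalanWords

open CatalanWords in
theorem mainTheorem7 {F : Type*} [Field F] [CharZero F] (w v : F) :
    ∃ S : F⸨X⸩⟦X⟧,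
      HasSum
        (fun j : ℕ =>
          q ^ j *
            PowerSeries.C (const w * sqrtX /
              ((chebU (j + 1) - const w * sqrtX * chebU j) *
                (chebU j - const w * sqrtX * chebU (j - 1)))) *
            (PowerSeries.C (A₂ (const v * L w j) - A₂ (const v)) -
              q * numerSeries v * (1 + q * denomSeries)⁻¹)) S ∧
      fullSeries w v = q * S := by
  have hw : ∀ j : ℕ, const w * sqrtX / ((chebU (j + 1) - const w * sqrtX * chebU j) *
      (chebU j - const w * sqrtX * chebU (j - 1))) = weight w j := fun j => by
    rw [weight, den, den, add_sub_cancel_right]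
  simp only [hw, ← fullSeries_one]
  have hc : ∀ j d : ℕ, PowerSeries.coeff d (q ^ j * PowerSeries.C (weight w j) *
      (PowerSeries.C (A₂ (const v * L w j) - A₂ (const v)) - fullSeries 1 v)) =
      if j ≤ d then weight w j * PowerSeries.coeff (d - j)
        (PowerSeries.C (A₂ (const v * L w j) - A₂ (const v)) - fullSeries 1 v) else 0 := by
    intro j d
    rw [mul_assoc, q, PowerSeries.coeff_X_pow_mul', PowerSeries.coeff_C_mul]
  refine ⟨PowerSeries.mk fun d => PowerSeries.coeff (d + 1) (fullSeries w v), ?_, ?_⟩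
  · rw [PowerSeries.WithPiTopology.hasSum_iff_hasSum_coeff]
    intro d
    rw [PowerSeries.coeff_mk, coeff_fullSeries_eq_sum]
    have h := hasSum_sum_of_ne_finset_zero (α := F⸨X⸩) (L := SummationFilter.unconditional ℕ)
      (f := fun j => PowerSeries.coeff d (q ^ j * PowerSeries.C (weight w j) *
        (PowerSeries.C (A₂ (const v * L w j) - A₂ (const v)) - fullSeries 1 v)))
      (s := Finset.range (d + 1)) (fun j hj => by
        rw [hc, if_neg]
        simpa [Nat.lt_succ_iff] using hj)
    rw [Finset.sum_congr rfl fun j hj => by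
      rw [hc, if_pos (Nat.lt_succ_iff.1 (Finset.mem_range.1 hj))]] at h
    exact h
  · ext n
    cases n with
    | zero => simp [q, coeff_fullSeries_zero]
    | succ i => rw [q, PowerSeries.coeff_succ_X_mul, PowerSeries.coeff_mk]
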